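/- All spaces are metrizable. A subset $A$ of a space $X$ is called $\sigma$-discrete if it is the union of countably many discrete subsets. A space $X$ is called a $\Lambda$-set if every $\sigma$-discrete subset of $X$ is a $G_\delta$-set in $X$, and $h$-homogeneous if its large inductive dimension satisfies $\operatorname{Ind} X = 0$ and every nonempty clopen subset of $X$ is homeomorphic to $X$. Theorem. Let $X$ be an $h$-homogeneous metrizable $\Lambda$-set that is not itself $\sigma$-discrete. If $A$ is a $\sigma$-discrete subset of $X$, then $X$ is homeomorphic to $X \setminus A$. -/

import Mathlib

open Set Topology

universe u

/-- `LargeIndLT n X` says that the large inductive dimension of `X` is `< n`, that is `Ind X ≤ n - 1`: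
`Ind X ≤ -1` iff `X` is empty, and `Ind X ≤ n` iff for every closed `F` and every open `V ⊇ F` there
is an open `U` with `F ⊆ U ⊆ V` whose boundary satisfies `Ind (Fr U) ≤ n - 1`.
(The notion is used for normal spaces only.) -/
def LargeIndLT : ℕ → (X : Type u) → [TopologicalSpace X] → Prop
  | 0, X, _ => IsEmpty X
  | n + 1, X, _ => ∀ F V : Set X, IsClosed F → IsOpen V → F ⊆ V →
      ∃ U : Set X, IsOpen U ∧ F ⊆ U ∧ U ⊆ V ∧ LargeIndLT n (frontier U)

/-- `Ind X = n` for a natural number `n`: `Ind X ≤ n` holds and `Ind X ≤ n - 1` fails. -/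
def LargeIndEq (X : Type u) [TopologicalSpace X] (n : ℕ) : Prop :=
  LargeIndLT (n + 1) X ∧ ¬ LargeIndLT n X

/-- `X` is h-homogeneous: `Ind X = 0` and every nonempty clopen subset of `X` is homeomorphic
to `X`. -/
def IsHHomogeneous (X : Type u) [TopologicalSpace X] : Prop :=
  LargeIndEq X 0 ∧ ∀ U : Set X, IsClopen U → U.Nonempty → Nonempty (U ≃ₜ X)

/-- A set is σ-discrete if it is the union of countably many discrete subsets
(`IsDiscrete D`: the subspace topology on `D` is discrete). -/
def IsSigmaDiscrete {X : Type u} [TopologicalSpace X] (A : Set X) : Prop :=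
  ∃ D : ℕ → Set X, (∀ n, IsDiscrete (D n)) ∧ A = ⋃ n, D n

/-- `X` is a Λ-set: every σ-discrete subset of `X` is a `G_δ`-set. -/
def IsLambdaSet (X : Type u) [TopologicalSpace X] : Prop :=
  ∀ A : Set X, IsSigmaDiscrete A → IsGδ A

/-! The homeomorphism of `X` onto `Aᶜ` is a limit of self-homeomorphisms of `X`, each agreeing with
its predecessor on a closed set whose image misses `A`; these closed sets grow to cover `X`.
Successive maps and their inverses are `2⁻ⁿ`-close, and pointwise stationarity replaces completeness
(`nonempty_homeomorph_compl_of_uniform_limit`).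

A σ-discrete set has empty interior, so h-homogeneity allows any point of `A` to be pushed off `A`
by a small homeomorphism (`exists_homeomorph_swap`). To keep other points from entering `A`, enlarge
`A` to a σ-discrete `A'` whose complement is mapped into itself by all these moves
(`exists_isSigmaDiscrete_superset`). By the Λ-property `Aᶜ` and `A'ᶜ` are F_σ. Closed pieces of
`A'ᶜ` can be frozen at once, and freezing preimages of closed pieces of `Aᶜ` gives surjectivity.
Finally `A'` is a countable union of uniformly separated sets, each frozen once moved off `A`
(`exists_homeomorph_image_notMem`). -/

/-! ### σ-discrete sets -/

theorem IsSigmaDiscrete.mono {X : Type u} [TopologicalSpace X] {A B : Set X}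
    (hB : IsSigmaDiscrete B) (hAB : A ⊆ B) : IsSigmaDiscrete A := by
  obtain ⟨D, hD, rfl⟩ := hB
  refine ⟨fun n => D n ∩ A, fun n => (hD n).mono inter_subset_left, ?_⟩
  rw [← iUnion_inter]
  exact (inter_eq_right.2 hAB).symm

theorem IsSigmaDiscrete.iUnion {X : Type u} [TopologicalSpace X] {S : ℕ → Set X}
    (hS : ∀ n, IsSigmaDiscrete (S n)) : IsSigmaDiscrete (⋃ n, S n) := by
  choose D hD hSD using hS
  refine ⟨fun k => D k.unpair.1 k.unpair.2, fun k => hD _ _, ?_⟩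
  rw [iUnion_unpair]
  exact iUnion_congr hSD

theorem IsSigmaDiscrete.union {X : Type u} [TopologicalSpace X] {A B : Set X}
    (hA : IsSigmaDiscrete A) (hB : IsSigmaDiscrete B) : IsSigmaDiscrete (A ∪ B) := by
  have h : IsSigmaDiscrete (⋃ n : ℕ, if n = 0 then A else B) := by
    refine .iUnion fun n => ?_
    split_ifs
    exacts [hA, hB]
  refine h.mono (union_subset ?_ ?_)
  · exact fun x hx => mem_iUnion.2 ⟨0, by simpa using hx⟩
  · exact fun x hx => mem_iUnion.2 ⟨1, by simpa using hx⟩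

theorem IsDiscrete.isSigmaDiscrete {X : Type u} [TopologicalSpace X] {A : Set X}
    (hA : IsDiscrete A) : IsSigmaDiscrete A :=
  ⟨fun _ => A, fun _ => hA, (iUnion_const A).symm⟩

theorem IsSigmaDiscrete.image {X Y : Type u} [TopologicalSpace X] [TopologicalSpace Y]
    {A : Set X} (hA : IsSigmaDiscrete A) {f : X → Y} (hf : IsInducing f) :
    IsSigmaDiscrete (f '' A) := by
  obtain ⟨D, hD, rfl⟩ := hA
  exact ⟨fun n => f '' D n, fun n => (hD n).image hf, image_iUnion⟩

theorem IsSigmaDiscrete.preimage {X Y : Type u} [TopologicalSpace X] [TopologicalSpace Y]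
    {A : Set Y} (hA : IsSigmaDiscrete A) (f : X ≃ₜ Y) : IsSigmaDiscrete (f ⁻¹' A) := by
  rw [← f.image_symm]
  exact hA.image f.symm.isInducing

/-- Disjointness of the open sets lets the `n`-th discrete layers be merged, so the index set may be
uncountable. -/
theorem IsSigmaDiscrete.iUnion_inter_of_pairwise_disjoint {X : Type u} [TopologicalSpace X]
    {ι : Type*} {O S : ι → Set X} (hO : ∀ i, IsOpen (O i))
    (hd : Pairwise fun i j => Disjoint (O i) (O j)) (hS : ∀ i, IsSigmaDiscrete (S i)) :
    IsSigmaDiscrete (⋃ i, O i ∩ S i) := by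
  choose D hD hSD using hS
  refine ⟨fun n => ⋃ i, O i ∩ D i n, fun n => ?_, ?_⟩
  · rw [isDiscrete_iff_forall_mem_exists_isOpen]
    intro y hy
    obtain ⟨i, hyO, hyD⟩ := mem_iUnion.1 hy
    obtain ⟨u, hu, huy⟩ := (isDiscrete_iff_forall_mem_exists_isOpen.1 (hD i n)) y hyD
    refine ⟨u ∩ O i, hu.inter (hO i), Subset.antisymm ?_ ?_⟩
    · rintro z ⟨⟨hzu, hzi⟩, hz⟩
      obtain ⟨j, hzj, hzD⟩ := mem_iUnion.1 hz
      have hij : i = j := by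
        by_contra h
        exact disjoint_left.1 (hd h) hzi hzj
      subst hij
      exact huy ▸ ⟨hzu, hzD⟩
    · rintro z rfl
      have : z ∈ u ∩ D i n := huy ▸ mem_singleton z
      exact ⟨⟨this.1, hyO⟩, hy⟩
  · rw [iUnion_comm]
    refine iUnion_congr fun i => ?_
    rw [hSD, inter_iUnion]

/-- A σ-discrete subset of a metric space is a countable union of uniformly separated sets. -/
theorem IsSigmaDiscrete.exists_separated {X : Type u} [MetricSpace X] {A : Set X}
    (hA : IsSigmaDiscrete A) :
    ∃ (E : ℕ → Set X) (δ : ℕ → ℝ), (∀ n, 0 < δ n) ∧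
      (∀ n, (E n).Pairwise fun x y => δ n ≤ dist x y) ∧ A = ⋃ n, E n := by
  obtain ⟨D, hD, rfl⟩ := hA
  -- `k` codes a pair `(m, n)`: the points of `D m` isolated in it at scale `1 / (n + 1)`.
  refine ⟨fun k => {x ∈ D k.unpair.1 | Metric.ball x (1 / ((k.unpair.2 : ℝ) + 1)) ∩
    D k.unpair.1 = {x}}, fun k => 1 / ((k.unpair.2 : ℝ) + 1), fun k => by positivity, ?_, ?_⟩
  · intro k x hx y hy hxy
    by_contra! h
    have : y ∈ ({x} : Set X) := by
      rw [← hx.2]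
      exact ⟨by rwa [Metric.mem_ball, dist_comm], hy.1⟩
    exact hxy this.symm
  · rw [iUnion_unpair (fun m n => {x ∈ D m | Metric.ball x (1 / ((n : ℝ) + 1)) ∩ D m = {x}})]
    refine iUnion_congr fun m => Subset.antisymm ?_ (iUnion_subset fun n => sep_subset _ _)
    intro x hx
    obtain ⟨ε, hε, hxε⟩ := Metric.exists_ball_inter_eq_singleton_of_mem_discrete (hD m) hx
    obtain ⟨n, hn⟩ := exists_nat_one_div_lt hε
    refine mem_iUnion.2 ⟨n, hx, Subset.antisymm ?_ ?_⟩
    · exact hxε ▸ inter_subset_inter_left _ (Metric.ball_subset_ball hn.le)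
    · rintro y rfl
      exact ⟨Metric.mem_ball_self (by positivity), hx⟩

/-! ### Clopen neighbourhoods and h-homogeneity -/

theorem LargeIndLT.exists_isClopen {X : Type u} [TopologicalSpace X] [T1Space X]
    (h : LargeIndLT 1 X) {x : X} {N : Set X} (hN : N ∈ 𝓝 x) :
    ∃ U, IsClopen U ∧ x ∈ U ∧ U ⊆ N := by
  obtain ⟨V, hVN, hV, hxV⟩ := mem_nhds_iff.1 hN
  obtain ⟨U, -, hxU, hUV, hU⟩ := h {x} V isClosed_singleton hV (singleton_subset_iff.2 hxV)
  refine ⟨U, isClopen_iff_frontier_eq_empty.2 ?_, hxU rfl, hUV.trans hVN⟩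
  exact isEmpty_coe_sort.1 hU

/-- Otherwise `A` would contain a clopen copy of `X`, making `X` σ-discrete. -/
theorem IsHHomogeneous.interior_eq_empty {X : Type u} [TopologicalSpace X] [T1Space X]
    (hX : IsHHomogeneous X) (hns : ¬ IsSigmaDiscrete (univ : Set X))
    {A : Set X} (hA : IsSigmaDiscrete A) : interior A = ∅ := by
  by_contra hne
  obtain ⟨x, hx⟩ := nonempty_iff_ne_empty.2 hne
  obtain ⟨U, hU, hxU, hUA⟩ := hX.1.1.exists_isClopen (mem_interior_iff_mem_nhds.1 hx)
  obtain ⟨φ⟩ := hX.2 U hU ⟨x, hxU⟩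
  apply hns
  have hU' : IsSigmaDiscrete (univ : Set U) := by
    obtain ⟨D, hD, hUD⟩ := hA.mono hUA
    refine ⟨fun n => (↑) ⁻¹' D n, fun n => ?_, ?_⟩
    · rw [isDiscrete_iff_forall_mem_exists_isOpen]
      intro y hy
      obtain ⟨u, hu, huy⟩ := isDiscrete_iff_forall_mem_exists_isOpen.1 (hD n) y hy
      refine ⟨(↑) ⁻¹' u, hu.preimage continuous_subtype_val, ?_⟩
      rw [← preimage_inter, huy]
      ext z
      simp [Subtype.ext_iff]
    · rw [← preimage_iUnion, ← hUD, Subtype.coe_preimage_self]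
  have := hU'.image φ.isInducing
  rwa [image_univ, φ.surjective.range_eq] at this

/-! ### Interchanging two points -/

/-- A strictly decreasing clopen neighbourhood base at a non-isolated point. -/
theorem exists_strictAnti_clopen_basis {X : Type u} [MetricSpace X]
    (hc : ∀ x : X, ∀ N ∈ 𝓝 x, ∃ U, IsClopen U ∧ x ∈ U ∧ U ⊆ N) {b : X}
    (hb : ∀ N ∈ 𝓝 b, ∃ x ∈ N, x ≠ b) {N : Set X} (hN : N ∈ 𝓝 b) :
    ∃ P : ℕ → Set X, (∀ n, IsClopen (P n)) ∧ (∀ n, b ∈ P n) ∧ Antitone P ∧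
      (∀ n, (P n \ P (n + 1)).Nonempty) ∧ P 0 ⊆ N ∧ ∀ M ∈ 𝓝 b, ∃ n, P n ⊆ M := by
  have step : ∀ (k : ℕ) (P : {P : Set X // IsClopen P ∧ b ∈ P}),
      ∃ Q : {P : Set X // IsClopen P ∧ b ∈ P}, Q.1 ⊆ P.1 ∧
        Q.1 ⊆ Metric.ball b (1 / ((k : ℝ) + 1)) ∧ (P.1 \ Q.1).Nonempty := by
    rintro k ⟨P, hP, hbP⟩
    obtain ⟨x, hxP, hxb⟩ := hb P (hP.isOpen.mem_nhds hbP)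
    obtain ⟨Q, hQ, hbQ, hQs⟩ := hc b (P ∩ Metric.ball b (1 / ((k : ℝ) + 1)) ∩ {x}ᶜ)
      (Filter.inter_mem (Filter.inter_mem (hP.isOpen.mem_nhds hbP)
        (Metric.ball_mem_nhds _ (by positivity))) (isOpen_compl_singleton.mem_nhds hxb.symm))
    exact ⟨⟨Q, hQ, hbQ⟩, fun y hy => (hQs hy).1.1, fun y hy => (hQs hy).1.2,
      x, hxP, fun hx => (hQs hx).2 rfl⟩
  choose next h1 h2 h3 using step
  obtain ⟨U, hU, hbU, hUN⟩ := hc b N hN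
  let P : ℕ → {P : Set X // IsClopen P ∧ b ∈ P} := fun n => Nat.rec ⟨U, hU, hbU⟩ next n
  refine ⟨fun n => (P n).1, fun n => (P n).2.1, fun n => (P n).2.2,
    antitone_nat_of_succ_le fun n => h1 n (P n), fun n => h3 n (P n), hUN, ?_⟩
  intro M hM
  obtain ⟨ε, hε, hεM⟩ := Metric.mem_nhds_iff.1 hM
  obtain ⟨n, hn⟩ := exists_nat_one_div_lt hε
  exact ⟨n + 1, (h2 n (P n)).trans ((Metric.ball_subset_ball hn.le).trans hεM)⟩

/-- Glueing maps between the successive differences of two decreasing sequences of sets. -/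
theorem exists_continuousOn_glue_rings {X : Type u} [TopologicalSpace X] {P P' : ℕ → Set X}
    {b e : X} (hP : ∀ n, IsClopen (P n)) (hbP : ∀ n, b ∈ P n) (hPa : Antitone P)
    (hPb : ⋂ n, P n ⊆ {b}) (heP : ∀ n, e ∈ P' n) (hPa' : Antitone P')
    (hPe : ∀ M ∈ 𝓝 e, ∃ n, P' n ⊆ M) {f : ℕ → X → X}
    (hf : ∀ n, ContinuousOn (f n) (P n \ P (n + 1)))
    (hfm : ∀ n, MapsTo (f n) (P n \ P (n + 1)) (P' n)) :
    ∃ F : X → X, ContinuousOn F (P 0) ∧ F b = e ∧ ∀ n, EqOn F (f n) (P n \ P (n + 1)) := by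
  classical
  have huniq : ∀ {x m n}, x ∈ P m \ P (m + 1) → x ∈ P n \ P (n + 1) → m = n := by
    intro x m n hm hn
    by_contra hne
    rcases lt_or_gt_of_ne hne with h | h
    · exact hm.2 (hPa h hn.1)
    · exact hn.2 (hPa h hm.1)
  -- Inside `P 0` the default value `e` is used only at `b`, the one point in no ring.
  let F : X → X := fun x => if h : ∃ n, x ∈ P n \ P (n + 1) then f h.choose x else e
  have hF : ∀ n, EqOn F (f n) (P n \ P (n + 1)) := by
    intro n x hx
    have h : ∃ n, x ∈ P n \ P (n + 1) := ⟨n, hx⟩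
    simp only [F, dif_pos h]
    rw [huniq h.choose_spec hx]
  have hFb : F b = e := dif_neg fun ⟨n, hn⟩ => hn.2 (hbP _)
  have hring : ∀ k x, x ∈ P k → x ≠ b → ∃ n, k ≤ n ∧ x ∈ P n \ P (n + 1) := by
    intro k x hx hxb
    have hex : ∃ n, x ∉ P n := by
      by_contra! h
      exact hxb (hPb (mem_iInter.2 h))
    have h0 : k < Nat.find hex := by
      by_contra! h
      exact Nat.find_spec hex (hPa h hx)
    refine ⟨Nat.find hex - 1, by omega, ?_, ?_⟩
    · by_contra h
      exact Nat.find_min hex (by omega) h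
    · rw [Nat.sub_add_cancel (by omega)]
      exact Nat.find_spec hex
  refine ⟨F, fun x hx => ContinuousAt.continuousWithinAt ?_, hFb, hF⟩
  by_cases hxb : x = b
  · subst hxb
    rw [ContinuousAt, hFb]
    intro M hM
    obtain ⟨n, hn⟩ := hPe M hM
    rw [Filter.mem_map]
    refine Filter.mem_of_superset ((hP n).isOpen.mem_nhds (hbP n)) fun y hy => hn ?_
    by_cases hyx : y = x
    · subst hyx
      rw [hFb]
      exact heP n
    · obtain ⟨m, hnm, hm⟩ := hring n y hy hyx
      rw [hF m hm]
      exact hPa' hnm (hfm m hm)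
  · obtain ⟨n, -, hn⟩ := hring 0 x hx hxb
    have hopen : P n \ P (n + 1) ∈ 𝓝 x := ((hP n).diff (hP (n + 1))).isOpen.mem_nhds hn
    refine ((hf n).continuousAt hopen).congr ?_
    exact Filter.mem_of_superset hopen fun y hy => (hF n hy).symm

/-- Interchanging two non-isolated points of an h-homogeneous space inside a given clopen set. -/
theorem IsHHomogeneous.exists_homeomorph_swap {X : Type u} [MetricSpace X]
    (hX : IsHHomogeneous X) (hiso : ∀ x : X, ∀ N ∈ 𝓝 x, ∃ y ∈ N, y ≠ x)
    {O : Set X} (hO : IsOpen O) {b e : X} (hbO : b ∈ O) (heO : e ∈ O) (hbe : b ≠ e) :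
    ∃ T : X ≃ₜ X, T b = e ∧ ∀ x ∉ O, T x = x := by
  classical
  have hc : ∀ x : X, ∀ N ∈ 𝓝 x, ∃ U, IsClopen U ∧ x ∈ U ∧ U ⊆ N :=
    fun x N hN => hX.1.1.exists_isClopen hN
  obtain ⟨u, v, hu, hv, hbu, hev, huv⟩ := t2_separation hbe
  obtain ⟨P, hP, hbP, hPa, hPn, hP0, hPb⟩ := exists_strictAnti_clopen_basis hc (hiso b)
    ((hO.inter hu).mem_nhds ⟨hbO, hbu⟩)
  obtain ⟨Q, hQ, heQ, hQa, hQn, hQ0, hQe⟩ := exists_strictAnti_clopen_basis hc (hiso e)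
    ((hO.inter hv).mem_nhds ⟨heO, hev⟩)
  have hPQ : ∀ x ∈ P 0, x ∉ Q 0 := fun x h h' => disjoint_left.1 huv (hP0 h).2 (hQ0 h').2
  -- Both rings are nonempty and clopen, hence copies of `X`.
  let φ : ∀ n, ↥(P n \ P (n + 1)) ≃ₜ ↥(Q n \ Q (n + 1)) := fun n =>
    (hX.2 _ ((hP n).diff (hP (n + 1))) (hPn n)).some.trans
      (hX.2 _ ((hQ n).diff (hQ (n + 1))) (hQn n)).some.symm
  have hinter : ∀ {R : ℕ → Set X} {c : X}, (∀ M ∈ 𝓝 c, ∃ n, R n ⊆ M) → ⋂ n, R n ⊆ {c} := by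
    intro R c hR x hx
    by_contra hxc
    obtain ⟨n, hn⟩ := hR {x}ᶜ (isOpen_compl_singleton.mem_nhds (Ne.symm hxc))
    exact hn (mem_iInter.1 hx n) rfl
  have key : ∀ {R S : Set X} (ψ : R ≃ₜ S), ∃ f : X → X, ContinuousOn f R ∧
      ∀ x : R, f x = ψ x := by
    intro R S ψ
    refine ⟨fun x => if h : x ∈ R then ψ ⟨x, h⟩ else x, ?_, fun x => dif_pos x.2⟩
    rw [continuousOn_iff_continuous_domRestrict]
    refine (continuous_subtype_val.comp ψ.continuous).congr fun x => ?_
    simp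
  choose f hf hfφ using fun n => key (φ n)
  choose g hg hgφ using fun n => key (φ n).symm
  obtain ⟨F, hF, hFb, hFf⟩ := exists_continuousOn_glue_rings hP hbP hPa (hinter hPb) heQ hQa hQe hf
    (fun n x hx => by rw [hfφ n ⟨x, hx⟩]; exact (φ n ⟨x, hx⟩).2.1)
  obtain ⟨G, hG, hGe, hGg⟩ := exists_continuousOn_glue_rings hQ heQ hQa (hinter hQe) hbP hPa hPb hg
    (fun n x hx => by rw [hgφ n ⟨x, hx⟩]; exact ((φ n).symm ⟨x, hx⟩).2.1)
  have hring : ∀ {R : ℕ → Set X} {c x : X}, (∀ M ∈ 𝓝 c, ∃ n, R n ⊆ M) → x ∈ R 0 → x ≠ c →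
      ∃ n, x ∈ R n \ R (n + 1) := by
    intro R c x hR hx hxc
    by_contra! h
    refine hxc (hinter hR (mem_iInter.2 fun n => ?_))
    induction n with
    | zero => exact hx
    | succ n ih => exact not_not.1 fun h' => h n ⟨ih, h'⟩
  have hFQ : ∀ x ∈ P 0, F x ∈ Q 0 ∧ G (F x) = x := by
    intro x hx
    by_cases hxb : x = b
    · subst hxb
      exact ⟨hFb ▸ heQ 0, hFb ▸ hGe⟩
    · obtain ⟨n, hn⟩ := hring hPb hx hxb
      have h1 : F x = φ n ⟨x, hn⟩ := (hFf n hn).trans (hfφ n ⟨x, hn⟩)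
      have h2 := (φ n ⟨x, hn⟩).2
      refine ⟨h1 ▸ hQa (Nat.zero_le n) h2.1, ?_⟩
      rw [h1, hGg n h2, hgφ n (φ n ⟨x, hn⟩), Homeomorph.symm_apply_apply]
  have hGP : ∀ x ∈ Q 0, G x ∈ P 0 ∧ F (G x) = x := by
    intro x hx
    by_cases hxe : x = e
    · subst hxe
      exact ⟨hGe ▸ hbP 0, hGe ▸ hFb⟩
    · obtain ⟨n, hn⟩ := hring hQe hx hxe
      have h1 : G x = (φ n).symm ⟨x, hn⟩ := (hGg n hn).trans (hgφ n ⟨x, hn⟩)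
      have h2 := ((φ n).symm ⟨x, hn⟩).2
      refine ⟨h1 ▸ hPa (Nat.zero_le n) h2.1, ?_⟩
      rw [h1, hFf n h2, hfφ n ((φ n).symm ⟨x, hn⟩), Homeomorph.apply_symm_apply]
  let T : X → X := fun x => if x ∈ P 0 then F x else if x ∈ Q 0 then G x else x
  have hTP : ∀ x ∈ P 0, T x = F x := fun x hx => if_pos hx
  have hTQ : ∀ x ∈ Q 0, T x = G x := fun x hx => by
    simp only [T, if_neg fun h => hPQ x h hx, if_pos hx]
  have hTo : ∀ x, x ∉ P 0 → x ∉ Q 0 → T x = x := fun x h h' => by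
    simp only [T, if_neg h, if_neg h']
  have hT : Continuous T := by
    rw [continuous_iff_continuousAt]
    intro x
    by_cases hx : x ∈ P 0
    · have hn := (hP 0).isOpen.mem_nhds hx
      exact (hF.continuousAt hn).congr (Filter.mem_of_superset hn fun y hy => (hTP y hy).symm)
    by_cases hx' : x ∈ Q 0
    · have hn := (hQ 0).isOpen.mem_nhds hx'
      exact (hG.continuousAt hn).congr (Filter.mem_of_superset hn fun y hy => (hTQ y hy).symm)
    have hn := ((hP 0).compl.isOpen.inter (hQ 0).compl.isOpen).mem_nhds ⟨hx, hx'⟩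
    exact continuousAt_id.congr (Filter.mem_of_superset hn fun y hy => (hTo y hy.1 hy.2).symm)
  have hTT : Function.Involutive T := by
    intro x
    by_cases hx : x ∈ P 0
    · rw [hTP x hx, hTQ _ (hFQ x hx).1, (hFQ x hx).2]
    by_cases hx' : x ∈ Q 0
    · rw [hTQ x hx', hTP _ (hGP x hx').1, (hGP x hx').2]
    rw [hTo x hx hx', hTo x hx hx']
  refine ⟨⟨hTT.toPerm, hT, hT⟩, (hTP b (hbP 0)).trans hFb, fun x hx => hTo x ?_ ?_⟩
  · exact fun h => hx (hP0 h).1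
  · exact fun h => hx (hQ0 h).1

/-! ### Enlarging `A` to a set with invariant complement -/

/-- A σ-discrete set with empty interior is contained in a σ-discrete set whose complement is
preserved by arbitrarily small homeomorphisms moving the points of the given set off it. -/
theorem IsHHomogeneous.exists_isSigmaDiscrete_superset {X : Type u} [MetricSpace X]
    (hX : IsHHomogeneous X) (hiso : ∀ x : X, ∀ N ∈ 𝓝 x, ∃ y ∈ N, y ≠ x)
    {A : Set X} (hA : IsSigmaDiscrete A) (hint : interior A = ∅) :
    ∃ A', A ⊆ A' ∧ IsSigmaDiscrete A' ∧ ∀ b ∈ A, ∀ N ∈ 𝓝 b, ∃ (O : Set X) (T : X ≃ₜ X),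
      IsClopen O ∧ b ∈ O ∧ O ⊆ N ∧ (∀ x ∉ O, T x = x) ∧ T b ∉ A ∧ ∀ x ∉ A', T x ∉ A' := by
  obtain ⟨E, δ, hδ, hE, hAE⟩ := hA.exists_separated
  have hEA : ∀ n (b : E n), (b : X) ∈ A := fun n b => hAE ▸ mem_iUnion.2 ⟨n, b.2⟩
  have hex : ∀ (n k : ℕ) (b : E n), ∃ (O : Set X) (T : X ≃ₜ X), IsClopen O ∧ (b : X) ∈ O ∧
      O ⊆ Metric.ball (b : X) (min (δ n / 2) (1 / ((k : ℝ) + 1))) ∧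
      (∀ x ∉ O, T x = x) ∧ T b ∉ A := by
    intro n k b
    -- Radius `δ n / 2` makes the sets for fixed `n`, `k` disjoint; `1 / (k + 1)` makes them
    -- arbitrarily small.
    obtain ⟨O, hO, hbO, hOs⟩ := hX.1.1.exists_isClopen (Metric.ball_mem_nhds (b : X)
      (lt_min (half_pos (hδ n)) (by positivity : 0 < 1 / ((k : ℝ) + 1))))
    obtain ⟨e, heO, heA⟩ : ∃ e ∈ O, e ∉ A := by
      by_contra! h
      have : (b : X) ∈ interior A := mem_interior.2 ⟨O, h, hO.isOpen, hbO⟩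
      simp [hint] at this
    obtain ⟨T, hTb, hT⟩ := hX.exists_homeomorph_swap hiso hO.isOpen hbO heO
      (fun h => heA (h ▸ hEA n b))
    exact ⟨O, T, hO, hbO, hOs, hT, hTb ▸ heA⟩
  choose O T hO hbO hOs hT hTb using hex
  -- Adds every point that some move sends into `S`; the union of the iterates is closed under this.
  let Φ : Set X → Set X := fun S => S ∪ ⋃ n, ⋃ k, ⋃ b : E n, O n k b ∩ T n k b ⁻¹' S
  have hΦ : ∀ j, IsSigmaDiscrete (Φ^[j] A) := by
    intro j
    induction j with
    | zero => exact hA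
    | succ j ih =>
      rw [Function.iterate_succ_apply']
      refine ih.union (.iUnion fun n => .iUnion fun k => ?_)
      refine .iUnion_inter_of_pairwise_disjoint (fun b => (hO n k b).isOpen) ?_
        fun b => ih.preimage (T n k b)
      intro b c hbc
      refine disjoint_left.2 fun x hxb hxc => ?_
      have h1 := lt_of_lt_of_le (Metric.mem_ball.1 (hOs n k b hxb)) (min_le_left _ _)
      have h2 := lt_of_lt_of_le (Metric.mem_ball.1 (hOs n k c hxc)) (min_le_left _ _)
      have h3 := hE n b.2 c.2 (fun h => hbc (Subtype.ext h))
      linarith [dist_triangle_left (b : X) c x]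
  refine ⟨⋃ j, Φ^[j] A, subset_iUnion (fun j => Φ^[j] A) 0, .iUnion hΦ, fun b hb N hN => ?_⟩
  obtain ⟨n, hn⟩ := mem_iUnion.1 (hAE ▸ hb)
  obtain ⟨ε, hε, hεN⟩ := Metric.mem_nhds_iff.1 hN
  obtain ⟨k, hk⟩ := exists_nat_one_div_lt hε
  refine ⟨O n k ⟨b, hn⟩, T n k ⟨b, hn⟩, hO _ _ _, hbO _ _ _, fun x hx => hεN ?_, hT _ _ _,
    hTb _ _ _, fun x hx hTx => hx ?_⟩
  · exact Metric.ball_subset_ball ((min_le_right _ _).trans hk.le) (hOs n k ⟨b, hn⟩ hx)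
  · by_cases hxO : x ∈ O n k ⟨b, hn⟩
    · obtain ⟨j, hj⟩ := mem_iUnion.1 hTx
      refine mem_iUnion.2 ⟨j + 1, ?_⟩
      rw [Function.iterate_succ_apply']
      exact .inr (mem_iUnion.2 ⟨n, mem_iUnion.2 ⟨k, mem_iUnion.2 ⟨⟨b, hn⟩, hxO, hj⟩⟩⟩)
    · rwa [hT n k ⟨b, hn⟩ x hxO] at hTx

/-! ### Gluing and perturbing homeomorphisms -/

theorem exists_continuous_glue_of_disjoint {X : Type u} [TopologicalSpace X] {ι : Type*}
    {O : ι → Set X} (hO : ∀ i, IsOpen (O i)) (hd : Pairwise fun i j => Disjoint (O i) (O j))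
    (hcl : IsClosed (⋃ i, O i)) {f : ι → X → X} (hf : ∀ i, Continuous (f i)) :
    ∃ F : X → X, Continuous F ∧ (∀ i, ∀ x ∈ O i, F x = f i x) ∧ ∀ x ∉ ⋃ i, O i, F x = x := by
  classical
  let F : X → X := fun x => if h : ∃ i, x ∈ O i then f h.choose x else x
  have h1 : ∀ i, ∀ x ∈ O i, F x = f i x := by
    intro i x hx
    have h : ∃ i, x ∈ O i := ⟨i, hx⟩
    have hi : h.choose = i := by
      by_contra hne
      exact disjoint_left.1 (hd hne) h.choose_spec hx
    simp only [F, dif_pos h, hi]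
  have h2 : ∀ x ∉ ⋃ i, O i, F x = x := fun x hx => dif_neg fun h => hx (mem_iUnion.2 h)
  refine ⟨F, continuous_iff_continuousAt.2 fun x => ?_, h1, h2⟩
  by_cases hx : x ∈ ⋃ i, O i
  · obtain ⟨i, hi⟩ := mem_iUnion.1 hx
    exact (hf i).continuousAt.congr
      (Filter.mem_of_superset ((hO i).mem_nhds hi) fun y hy => (h1 i y hy).symm)
  · exact continuousAt_id.congr
      (Filter.mem_of_superset (hcl.isOpen_compl.mem_nhds hx) fun y hy => (h2 y hy).symm)

theorem Homeomorph.apply_mem_of_eq_off {X : Type u} [TopologicalSpace X] {T : X ≃ₜ X}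
    {O : Set X} (hT : ∀ x ∉ O, T x = x) {x : X} (hx : x ∈ O) : T x ∈ O := by
  by_contra h
  exact h ((T.injective (hT _ h)).symm ▸ hx)

theorem Homeomorph.symm_apply_eq_off {X : Type u} [TopologicalSpace X] {T : X ≃ₜ X}
    {O : Set X} (hT : ∀ x ∉ O, T x = x) : ∀ x ∉ O, T.symm x = x :=
  fun x hx => T.symm_apply_eq.2 (hT x hx).symm

theorem exists_homeomorph_glue_of_disjoint {X : Type u} [TopologicalSpace X] {ι : Type*}
    {O : ι → Set X} (hO : ∀ i, IsOpen (O i)) (hd : Pairwise fun i j => Disjoint (O i) (O j))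
    (hcl : IsClosed (⋃ i, O i)) {T : ι → X ≃ₜ X} (hT : ∀ i, ∀ x ∉ O i, T i x = x) :
    ∃ S : X ≃ₜ X, (∀ i, ∀ x ∈ O i, S x = T i x) ∧ ∀ x ∉ ⋃ i, O i, S x = x := by
  obtain ⟨F, hF, hF1, hF2⟩ := exists_continuous_glue_of_disjoint hO hd hcl
    fun i => (T i).continuous
  obtain ⟨G, hG, hG1, hG2⟩ := exists_continuous_glue_of_disjoint hO hd hcl
    fun i => (T i).symm.continuous
  refine ⟨⟨⟨F, G, fun x => ?_, fun x => ?_⟩, hF, hG⟩, hF1, hF2⟩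
  · by_cases hx : x ∈ ⋃ i, O i
    · obtain ⟨i, hi⟩ := mem_iUnion.1 hx
      rw [hF1 i x hi, hG1 i _ (Homeomorph.apply_mem_of_eq_off (hT i) hi),
        Homeomorph.symm_apply_apply]
    · rw [hF2 x hx, hG2 x hx]
  · by_cases hx : x ∈ ⋃ i, O i
    · obtain ⟨i, hi⟩ := mem_iUnion.1 hx
      rw [hG1 i x hi, hF1 i _ (Homeomorph.apply_mem_of_eq_off
        (Homeomorph.symm_apply_eq_off (hT i)) hi), Homeomorph.apply_symm_apply]
    · rw [hG2 x hx, hF2 x hx]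

/-- Subsets of a uniformly separated set have locally finite families of neighbourhoods. -/
theorem locallyFinite_of_subset_ball {X : Type u} [PseudoMetricSpace X] {D : Set X} {δ : ℝ}
    (hδ : 0 < δ) (hD : D.Pairwise fun x y => δ ≤ dist x y) {W : D → Set X}
    (hW : ∀ a : D, W a ⊆ Metric.ball (a : X) (δ / 4)) : LocallyFinite W := by
  intro x
  refine ⟨Metric.ball x (δ / 4), Metric.ball_mem_nhds _ (by positivity),
    Set.Subsingleton.finite ?_⟩
  rintro a ⟨y, hya, hyx⟩ c ⟨z, hzc, hzx⟩
  by_contra hac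
  have h1 := Metric.mem_ball.1 (hW a hya)
  have h2 := Metric.mem_ball.1 (hW c hzc)
  have h3 := hD a.2 c.2 (fun h => hac (Subtype.ext h))
  rw [Metric.mem_ball] at hyx hzx
  have h4 := dist_triangle_left (a : X) x y
  have h5 := dist_triangle_left x (c : X) z
  linarith [dist_triangle (a : X) x c]

/-- A small modification of a homeomorphism, fixed on a given closed set, that moves the image of
a uniformly separated set off `A`. -/
theorem exists_homeomorph_image_notMem {X : Type u} [MetricSpace X] {A A' : Set X}
    (H : ∀ b ∈ A, ∀ N ∈ 𝓝 b, ∃ (O : Set X) (T : X ≃ₜ X),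
      IsClopen O ∧ b ∈ O ∧ O ⊆ N ∧ (∀ x ∉ O, T x = x) ∧ T b ∉ A ∧ ∀ x ∉ A', T x ∉ A')
    (h : X ≃ₜ X) (hh : ∀ x ∉ A', h x ∉ A') {F : Set X} (hF : IsClosed F)
    (hFA : ∀ x ∈ F, h x ∉ A) {E : Set X} {δ : ℝ} (hδ : 0 < δ)
    (hE : E.Pairwise fun x y => δ ≤ dist x y) {ε : ℝ} (hε : 0 < ε) :
    ∃ g : X ≃ₜ X, EqOn g h F ∧ (∀ x ∈ E, g x ∉ A) ∧ (∀ x ∉ A', g x ∉ A') ∧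
      (∀ x, dist (h x) (g x) ≤ ε) ∧ ∀ y, dist (h.symm y) (g.symm y) ≤ ε := by
  let D : Set X := {a ∈ E | h a ∈ A}
  -- Points of `E` already sent off `A` are frozen too, so that moving the others cannot disturb
  -- them.
  let F' : Set X := F ∪ {a ∈ E | h a ∉ A}
  have hF' : IsClosed F' := hF.union
    (Metric.isClosed_of_pairwise_le_dist hδ (hE.mono (sep_subset _ _)))
  have hF'A : ∀ x ∈ F', h x ∉ A := by
    rintro x (hx | hx)
    exacts [hFA x hx, hx.2]
  -- The first condition on `O` protects `F'`; the `ε / 2` balls control the maps and their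
  -- inverses; `δ / 4` gives disjointness and local finiteness.
  have hex : ∀ a : D, ∃ (O : Set X) (T : X ≃ₜ X), IsClopen O ∧ h a ∈ O ∧
      O ⊆ h.symm ⁻¹' F'ᶜ ∩ Metric.ball (h a) (ε / 2) ∩
        h.symm ⁻¹' Metric.ball (a : X) (min (ε / 2) (δ / 4)) ∧
      (∀ x ∉ O, T x = x) ∧ T (h a) ∉ A ∧ ∀ x ∉ A', T x ∉ A' := by
    intro a
    refine H (h a) a.2.2 _ (Filter.inter_mem (Filter.inter_mem ?_
      (Metric.ball_mem_nhds _ (half_pos hε))) ?_)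
    · refine (hF'.isOpen_compl.preimage h.symm.continuous).mem_nhds ?_
      rw [mem_preimage, h.symm_apply_apply]
      exact fun ha => hF'A a ha a.2.2
    · refine (Metric.isOpen_ball.preimage h.symm.continuous).mem_nhds ?_
      rw [mem_preimage, h.symm_apply_apply]
      exact Metric.mem_ball_self (lt_min (half_pos hε) (by positivity))
  choose O T hO haO hOs hT hTa hTA' using hex
  have hD : D.Pairwise fun x y => δ ≤ dist x y := hE.mono (sep_subset _ _)
  have hsub : ∀ a : D, h ⁻¹' O a ⊆ Metric.ball (a : X) (δ / 4) := by
    intro a x hx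
    have := (hOs a hx).2
    rw [mem_preimage, h.symm_apply_apply] at this
    exact Metric.ball_subset_ball (min_le_right _ _) this
  have hlf : LocallyFinite O := by
    have := (locallyFinite_of_subset_ball hδ hD hsub).preimage_continuous h.symm.continuous
    refine this.subset fun a y hy => ?_
    rwa [mem_preimage, mem_preimage, h.apply_symm_apply]
  have hdisj : Pairwise fun a c => Disjoint (O a) (O c) := by
    intro a c hac
    refine disjoint_left.2 fun y hya hyc => ?_
    have hpre : ∀ {a}, y ∈ O a → h.symm y ∈ h ⁻¹' O a := fun hy => by
      rwa [mem_preimage, h.apply_symm_apply]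
    have h1 := Metric.mem_ball.1 (hsub a (hpre hya))
    have h2 := Metric.mem_ball.1 (hsub c (hpre hyc))
    have h3 := hD a.2 c.2 (fun h => hac (Subtype.ext h))
    linarith [dist_triangle_left (a : X) c (h.symm y)]
  obtain ⟨S, hS1, hS2⟩ := exists_homeomorph_glue_of_disjoint (fun a => (hO a).isOpen) hdisj
    (hlf.isClosed_iUnion fun a => (hO a).isClosed) hT
  have hSO : ∀ a, ∀ x ∈ O a, S x ∈ O a := fun a x hx => by
    rw [hS1 a x hx]
    exact Homeomorph.apply_mem_of_eq_off (hT a) hx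
  have hfix : ∀ x ∈ F', S (h x) = h x := by
    intro x hx
    refine hS2 _ fun hmem => ?_
    obtain ⟨a, ha⟩ := mem_iUnion.1 hmem
    have := (hOs a ha).1.1
    rw [mem_preimage, h.symm_apply_apply] at this
    exact this hx
  refine ⟨h.trans S, fun x hx => hfix x (.inl hx), fun x hx => ?_, fun x hx => ?_, fun x => ?_,
    fun y => ?_⟩
  · rw [Homeomorph.trans_apply]
    by_cases hxA : h x ∈ A
    · rw [hS1 ⟨x, hx, hxA⟩ _ (haO _)]
      exact hTa ⟨x, hx, hxA⟩
    · rwa [hfix x (.inr ⟨hx, hxA⟩)]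
  · rw [Homeomorph.trans_apply]
    by_cases hxO : h x ∈ ⋃ a, O a
    · obtain ⟨a, ha⟩ := mem_iUnion.1 hxO
      rw [hS1 a _ ha]
      exact hTA' a _ (hh x hx)
    · rw [hS2 _ hxO]
      exact hh x hx
  · rw [Homeomorph.trans_apply]
    by_cases hxO : h x ∈ ⋃ a, O a
    · obtain ⟨a, ha⟩ := mem_iUnion.1 hxO
      have h1 := Metric.mem_ball.1 (hOs a ha).1.2
      have h2 := Metric.mem_ball.1 (hOs a (hSO a _ ha)).1.2
      linarith [dist_triangle_right (h x) (S (h x)) (h a)]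
    · rw [hS2 _ hxO, dist_self]
      exact hε.le
  · obtain ⟨z, rfl⟩ := S.surjective y
    rw [Homeomorph.symm_trans_apply, S.symm_apply_apply]
    by_cases hxO : z ∈ ⋃ a, O a
    · obtain ⟨a, ha⟩ := mem_iUnion.1 hxO
      have h1 := lt_of_lt_of_le (Metric.mem_ball.1 (hOs a ha).2) (min_le_left _ _)
      have h2 := lt_of_lt_of_le (Metric.mem_ball.1 (hOs a (hSO a _ ha)).2) (min_le_left _ _)
      linarith [dist_triangle_right (h.symm (S z)) (h.symm z) (a : X)]
    · rw [hS2 _ hxO, dist_self]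
      exact hε.le

/-! ### Passing to the limit -/

/-- A sequence of self-homeomorphisms that, together with the inverses, is uniformly Cauchy and is
stationary on larger and larger sets has a limit which is a homeomorphism onto `Aᶜ`. -/
theorem nonempty_homeomorph_compl_of_uniform_limit {X : Type u} [MetricSpace X] {A : Set X}
    (h : ℕ → X ≃ₜ X) (F : ℕ → Set X) (hmono : ∀ n, F n ⊆ F (n + 1))
    (hFu : ∀ x, ∃ n, x ∈ F n) (heq : ∀ n, EqOn (h (n + 1)) (h n) (F n))
    (hFA : ∀ n, ∀ x ∈ F n, h n x ∉ A) (hsurj : ∀ y ∉ A, ∃ n, ∃ x ∈ F n, h n x = y)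
    (hd : ∀ n x, dist (h n x) (h (n + 1) x) ≤ 1 * (1 / 2 : ℝ) ^ n)
    (hd' : ∀ n y, dist ((h n).symm y) ((h (n + 1)).symm y) ≤ 1 * (1 / 2 : ℝ) ^ n) :
    Nonempty ((Aᶜ : Set X) ≃ₜ X) := by
  have hstat : ∀ {n x}, x ∈ F n → ∀ m, n ≤ m → h m x = h n x := by
    intro n x hx m hm
    induction m, hm using Nat.le_induction with
    | base => rfl
    | succ m hm ih => rw [heq m (monotone_nat_of_le_succ hmono hm hx), ih]
  choose N hN using hFu
  let L : X → X := fun x => h (N x) x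
  have hL : ∀ {n x}, x ∈ F n → ∀ m, n ≤ m → h m x = L x := by
    intro n x hx m hm
    rw [hstat hx m hm, ← hstat hx _ (le_max_left n (N x)), hstat (hN x) _ (le_max_right n (N x))]
  have hLinj : Function.Injective L := by
    intro x y hxy
    rw [← hL (hN x) _ (le_max_left (N x) (N y)), ← hL (hN y) _ (le_max_right (N x) (N y))] at hxy
    exact (h _).injective hxy
  have hunif : ∀ {Y : Type u} (f : ℕ → Y → X) (g : Y → X),
      (∀ n y, dist (f n y) (f (n + 1) y) ≤ 1 * (1 / 2 : ℝ) ^ n) →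
      (∀ y, ∃ n, ∀ m, n ≤ m → f m y = g y) → TendstoUniformly f g Filter.atTop := by
    intro Y f g hfd hfg
    rw [Metric.tendstoUniformly_iff]
    intro ε hε
    obtain ⟨k, hk⟩ := exists_pow_lt_of_lt_one (half_pos hε) (by norm_num : (1 / 2 : ℝ) < 1)
    filter_upwards [Filter.eventually_ge_atTop k] with n hn y
    obtain ⟨m, hm⟩ := hfg y
    have hlim : Filter.Tendsto (fun n => f n y) Filter.atTop (𝓝 (g y)) :=
      tendsto_const_nhds.congr' (Filter.eventually_atTop.2 ⟨m, fun b hb => (hm b hb).symm⟩)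
    have h1 := dist_le_of_le_geometric_of_tendsto (1 / 2 : ℝ) 1 (by norm_num)
      (fun n => hfd n y) hlim n
    have h2 : (1 / 2 : ℝ) ^ n ≤ (1 / 2 : ℝ) ^ k :=
      pow_le_pow_of_le_one (by norm_num) (by norm_num) hn
    rw [dist_comm]
    have h3 : (1 : ℝ) * (1 / 2) ^ n / (1 - 1 / 2) = 2 * (1 / 2) ^ n := by ring
    linarith
  have hLc : Continuous L :=
    (hunif (fun n => h n) L hd fun x => ⟨N x, hL (hN x)⟩).continuous
      (Filter.Frequently.of_forall fun n => (h n).continuous)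
  have hinv : ∀ y : (Aᶜ : Set X), ∃ x, L x = y := by
    rintro ⟨y, hy⟩
    obtain ⟨n, x, hx, hxy⟩ := hsurj y hy
    exact ⟨x, (hL hx n le_rfl).symm.trans hxy⟩
  choose K hK using hinv
  have hKc : Continuous K := by
    -- The inverses are only considered on `Aᶜ`, where they are eventually stationary.
    refine (hunif (fun n (y : (Aᶜ : Set X)) => (h n).symm y) K (fun n y => hd' n y)
      fun y => ⟨N (K y), fun m hm => ?_⟩).continuous
      (Filter.Frequently.of_forall fun n => (h n).symm.continuous.comp continuous_subtype_val)
    exact (h m).symm_apply_eq.2 ((hL (hN (K y)) m hm).trans (hK y)).symm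
  have hLA : ∀ x, L x ∈ Aᶜ := fun x => hFA _ x (hN x)
  exact ⟨⟨⟨K, fun x => ⟨L x, hLA x⟩, fun y => Subtype.ext (hK y),
    fun x => hLinj (hK ⟨L x, hLA x⟩)⟩, hKc, hLc.subtype_mk hLA⟩⟩

/-! ### The inductive construction -/

theorem IsGδ.exists_compl_eq_iUnion_isClosed {X : Type u} [TopologicalSpace X] {A : Set X}
    (hA : IsGδ A) : ∃ B : ℕ → Set X, (∀ n, IsClosed (B n)) ∧ Aᶜ = ⋃ n, B n := by
  obtain ⟨f, hf, rfl⟩ := isGδ_iff_eq_iInter_nat.1 hA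
  exact ⟨fun n => (f n)ᶜ, fun n => (hf n).isClosed_compl, compl_iInter f⟩

theorem theorem5 (X : Type u) [TopologicalSpace X] [TopologicalSpace.MetrizableSpace X]
    (hX : IsHHomogeneous X) (hΛ : IsLambdaSet X)
    (hns : ¬ IsSigmaDiscrete (Set.univ : Set X))
    (A : Set X) (hA : IsSigmaDiscrete A) :
    Nonempty ((Aᶜ : Set X) ≃ₜ X) := by
  let _ : MetricSpace X := TopologicalSpace.metrizableSpaceMetric X
  have hiso : ∀ x : X, ∀ N ∈ 𝓝 x, ∃ y ∈ N, y ≠ x := by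
    intro x N hN
    by_contra! h
    have h0 := hX.interior_eq_empty hns
      (subsingleton_singleton (a := x)).isDiscrete.isSigmaDiscrete
    have h1 : x ∈ interior {x} := mem_interior_iff_mem_nhds.2 (Filter.mem_of_superset hN h)
    simp [h0] at h1
  obtain ⟨A', hAA', hA', H⟩ :=
    hX.exists_isSigmaDiscrete_superset hiso hA (hX.interior_eq_empty hns hA)
  obtain ⟨B, hB, hAB⟩ := (hΛ A hA).exists_compl_eq_iUnion_isClosed
  obtain ⟨B', hB', hAB'⟩ := (hΛ A' hA').exists_compl_eq_iUnion_isClosed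
  obtain ⟨E, δ, hδ, hE, hAE⟩ := hA'.exists_separated
  let State := {p : (X ≃ₜ X) × Set X //
    IsClosed p.2 ∧ (∀ x ∈ p.2, p.1 x ∉ A) ∧ ∀ x ∉ A', p.1 x ∉ A'}
  have step : ∀ (n : ℕ) (p : State), ∃ q : State, p.1.2 ⊆ q.1.2 ∧ EqOn q.1.1 p.1.1 p.1.2 ∧
      B' n ⊆ q.1.2 ∧ E n ⊆ q.1.2 ∧ (∀ y ∈ B n, ∃ x ∈ q.1.2, q.1.1 x = y) ∧
      (∀ x, dist (p.1.1 x) (q.1.1 x) ≤ 1 * (1 / 2 : ℝ) ^ n) ∧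
      ∀ y, dist (p.1.1.symm y) (q.1.1.symm y) ≤ 1 * (1 / 2 : ℝ) ^ n := by
    rintro n ⟨⟨h, F⟩, hF, hFA, hh⟩
    -- `B' n` can be frozen because `h` keeps `A'ᶜ` off `A'`; freezing `h ⁻¹' B n` secures `B n` in
    -- the image.
    let F' : Set X := F ∪ B' n ∪ h ⁻¹' B n
    have hF' : IsClosed F' := (hF.union (hB' n)).union ((hB n).preimage h.continuous)
    have hF'A : ∀ x ∈ F', h x ∉ A := by
      rintro x ((hx | hx) | hx)
      · exact hFA x hx
      · have : x ∈ A'ᶜ := hAB' ▸ mem_iUnion.2 ⟨n, hx⟩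
        exact fun hxA => hh x this (hAA' hxA)
      · have : h x ∈ Aᶜ := hAB ▸ mem_iUnion.2 ⟨n, hx⟩
        exact this
    obtain ⟨g, hgF, hgE, hgA', hd, hd'⟩ := exists_homeomorph_image_notMem H h hh hF' hF'A (hδ n)
      (hE n) (by positivity : (0 : ℝ) < 1 * (1 / 2 : ℝ) ^ n)
    -- `E n` joins only now: `g`, unlike `h`, is known to send it off `A`.
    refine ⟨⟨⟨g, F' ∪ E n⟩, hF'.union (Metric.isClosed_of_pairwise_le_dist (hδ n) (hE n)), ?_,
      hgA'⟩, fun x hx => .inl (.inl (.inl hx)), fun x hx => hgF (.inl (.inl hx)),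
      fun x hx => .inl (.inl (.inr hx)), fun x hx => .inr hx, fun y hy => ?_, hd, hd'⟩
    · rintro x (hx | hx)
      · exact fun hxA => hF'A x hx (hgF hx ▸ hxA)
      · exact hgE x hx
    · have hy' : h.symm y ∈ F' := .inr (by rwa [mem_preimage, h.apply_symm_apply])
      exact ⟨h.symm y, .inl hy', (hgF hy').trans (h.apply_symm_apply y)⟩
  choose next h1 h2 h3 h4 h5 h6 h7 using step
  let s : ℕ → State := fun n => Nat.rec
    ⟨⟨Homeomorph.refl X, ∅⟩, isClosed_empty, fun x hx => hx.elim, fun x hx => hx⟩ next n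
  refine nonempty_homeomorph_compl_of_uniform_limit (fun n => (s n).1.1) (fun n => (s n).1.2)
    (fun n => h1 n (s n)) (fun x => ?_) (fun n => h2 n (s n)) (fun n => (s n).2.2.1)
    (fun y hy => ?_) (fun n => h6 n (s n)) fun n => h7 n (s n)
  · by_cases hx : x ∈ A'
    · obtain ⟨n, hn⟩ := mem_iUnion.1 (hAE ▸ hx)
      exact ⟨n + 1, h4 n (s n) hn⟩
    · have hx' : x ∈ A'ᶜ := hx
      obtain ⟨n, hn⟩ := mem_iUnion.1 (hAB' ▸ hx')
      exact ⟨n + 1, h3 n (s n) hn⟩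
  · have hy' : y ∈ Aᶜ := hy
    obtain ⟨n, hn⟩ := mem_iUnion.1 (hAB ▸ hy')
    exact ⟨n + 1, h5 n (s n) y hn⟩
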